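/- A set $A$ of ordinals is called nowhere stationary if, for every ordinal $\alpha$ of uncountable cofinality, $A\cap\alpha$ is not stationary in $\alpha$; a set of cardinals is regarded as a set of (initial) ordinals. A hypergraph on a set $V$ is a family $\mathcal E$ of non-empty subsets (edges) of $V$. A vertex cover of $\mathcal E$ is a set $Y\subseteq\bigcup\mathcal E$ with $Y\cap E\neq\emptyset$ for every $E\in\mathcal E$; it is minimal if no proper subset of $Y$ is a vertex cover of $\mathcal E$. **Theorem.** Let $S$ be a nowhere stationary set of cardinals, let $\lambda$ be any cardinal and let $r<\omega$. Let $\mathcal E\subseteq[\lambda]^{S}=\{B\subseteq\lambda : |B|\in S\}$ be a hypergraph with property $C(2,r)$, that is, $|E\cap E'|<r$ for any two distinct $E,E'\in\mathcal E$. Then $\mathcal E$ has a minimal vertex cover. -/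

import Mathlib

universe u

/-- A set `A` of ordinals is nowhere stationary if `A ∩ α` is not stationary in `α` (the set of
ordinals below `α`) for every ordinal `α` of uncountable cofinality. -/
def NowhereStationary (A : Set Ordinal.{u}) : Prop :=
  ∀ α : Ordinal.{u}, Cardinal.aleph0 < α.cof →
    ¬ IsStationary ((fun x : Set.Iio α => (x : Ordinal.{u})) ⁻¹' A)

/-- A set of cardinals is nowhere stationary if the set of the corresponding initial ordinals is. -/
def NowhereStationaryCardinals (S : Set Cardinal.{u}) : Prop :=
  NowhereStationary (Cardinal.ord '' S)

namespace Hypergraphs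

variable {V : Type u}

/-- A family of subsets of `V` is (the edge set of) a hypergraph if its members are non-empty. -/
def IsHypergraph (𝓔 : Set (Set V)) : Prop :=
  ∀ E ∈ 𝓔, E.Nonempty

/-- `[V]^S`, the family of the subsets of `V` whose cardinality belongs to `S`. -/
def subsetsOfSize (V : Type u) (S : Set Cardinal.{u}) : Set (Set V) :=
  {B | Cardinal.mk B ∈ S}

/-- Property `C(k, ρ)`: any `k` distinct edges have fewer than `ρ` points in common. -/
def PropertyC (𝓔 : Set (Set V)) (k : ℕ) (ρ : Cardinal.{u}) : Prop :=
  ∀ 𝓕 : Set (Set V), 𝓕 ⊆ 𝓔 → Cardinal.mk 𝓕 = k → Cardinal.mk (⋂₀ 𝓕 : Set V) < ρ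

/-- A vertex cover is a set of vertices of the hypergraph that meets every edge. -/
def IsVertexCover (𝓔 : Set (Set V)) (Y : Set V) : Prop :=
  Y ⊆ ⋃₀ 𝓔 ∧ ∀ E ∈ 𝓔, (Y ∩ E).Nonempty

/-- A vertex cover is minimal if none of its proper subsets is a vertex cover. -/
def IsMinimalVertexCover (𝓔 : Set (Set V)) (Y : Set V) : Prop :=
  IsVertexCover 𝓔 Y ∧ ∀ Z : Set V, Z ⊂ Y → ¬ IsVertexCover 𝓔 Z

/-- `M(lam, S, k, ρ) → MinVC`: on a vertex set of cardinality `lam`, every hypergraph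
`𝓔 ⊆ [lam]^S` with property `C(k, ρ)` has a minimal vertex cover. -/
def MinVC (lam : Cardinal.{u}) (S : Set Cardinal.{u}) (k : ℕ) (ρ : Cardinal.{u}) : Prop :=
  ∀ V : Type u, Cardinal.mk V = lam →
    ∀ 𝓔 : Set (Set V), IsHypergraph 𝓔 → 𝓔 ⊆ subsetsOfSize V S → PropertyC 𝓔 k ρ →
      ∃ Y : Set V, IsMinimalVertexCover 𝓔 Y

end Hypergraphs

/-! A set that meets every edge is a minimal vertex cover as soon as each of its points is the only
one in some edge, its private edge. Such a set is built by transfinite recursion along an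
enumeration of the edges, through partial choices that decide, point by point, what belongs to the
cover. The points decided by stage `i` form a core of size less than `θ i` and fewer than `θ i`
edges that have already been met. Closing off the core is a problem on a smaller set of vertices,
namely to cover the undecided parts of the edges; it is solved by induction on the number of
vertices.

The danger is that, at a limit stage, most of an edge has been decided although the edge has not
been met. An edge of size less than some earlier `θ i` has fewer than `r` points in each later
core, by closing off. An edge larger than all the earlier stages together meets the edges used
there in few points, by almost disjointness. What remains are edges whose size is the limit of
the sizes of the earlier stages. Nowhere stationarity allows the sizes `θ i` to be taken along a
cofinal set of cardinals whose limits lie outside `S`, so that there are no such edges. -/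

namespace Hypergraphs

open Cardinal Set

variable {V : Type u}

/-! ### Cardinalities of sets -/

theorem mk_union_lt {c : Cardinal.{u}} (hc : ℵ₀ ≤ c) {A B : Set V} (hA : #A < c) (hB : #B < c) :
    #(A ∪ B : Set V) < c :=
  (mk_union_le A B).trans_lt (add_lt_of_lt hc hA hB)

theorem aleph0_le_mk_of_infinite {E : Set V} (hE : E.Infinite) : ℵ₀ ≤ #E :=
  Cardinal.aleph0_le_mk_iff.2 hE.to_subtype

theorem mk_lt_mk_of_finite_of_infinite {A E : Set V} (hA : A.Finite) (hE : E.Infinite) :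
    #A < #E :=
  hA.lt_aleph0.trans_le (aleph0_le_mk_of_infinite hE)

theorem mk_inter_union_lt {A B E : Set V} (hE : E.Infinite) (hA : #(E ∩ A : Set V) < #E)
    (hB : #(E ∩ B : Set V) < #E) : #(E ∩ (A ∪ B) : Set V) < #E := by
  rw [inter_union_distrib_left]
  exact mk_union_lt (aleph0_le_mk_of_infinite hE) hA hB

theorem mk_diff_eq_of_mk_inter_lt {A E : Set V} (hE : E.Infinite) (h : #(E ∩ A : Set V) < #E) :
    #(E \ A : Set V) = #E := by
  refine (mk_le_mk_of_subset sdiff_subset).antisymm (not_lt.1 fun hlt => ?_)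
  have hunion := mk_union_lt (aleph0_le_mk_of_infinite hE) h hlt
  rw [inter_union_sdiff] at hunion
  exact hunion.false

theorem mk_sUnion_le_of_le {κ : Cardinal.{u}} (hκ : ℵ₀ ≤ κ) {𝓕 : Set (Set V)} (h𝓕 : #𝓕 ≤ κ)
    (h : ∀ E ∈ 𝓕, #E ≤ κ) : #(⋃₀ 𝓕 : Set V) ≤ κ :=
  calc #(⋃₀ 𝓕 : Set V) ≤ #𝓕 * ⨆ E : 𝓕, #E := mk_sUnion_le 𝓕
    _ ≤ κ * κ := mul_le_mul' h𝓕 (ciSup_le' fun E => h E.1 E.2)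
    _ = κ := mul_eq_self hκ

theorem mk_setOf_finite_subset_le {κ : Cardinal.{u}} (hκ : ℵ₀ ≤ κ) {M : Set V} (hM : #M ≤ κ) :
    #{t : Set V | t.Finite ∧ t ⊆ M} ≤ κ := by
  have hsub : {t : Set V | t.Finite ∧ t ⊆ M} ⊆
      range fun s : Finset M => Subtype.val '' (s : Set M) := by
    rintro t ⟨htfin, htM⟩
    refine ⟨(htfin.preimage Subtype.val_injective.injOn).toFinset, ?_⟩
    simpa using htM
  refine ((mk_le_mk_of_subset hsub).trans mk_range_le).trans ?_
  rcases finite_or_infinite M with hfin | hinf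
  · exact (mk_lt_aleph0 (α := Finset M)).le.trans hκ
  · rwa [mk_finset_of_infinite]

theorem exists_subset_of_finite_of_subset_iUnion {ι : Type*} [Nonempty ι] [Preorder ι]
    [IsDirectedOrder ι] {M : ι → Set V} (hM : Monotone M) {t : Set V} (ht : t.Finite)
    (h : t ⊆ ⋃ i, M i) : ∃ i, t ⊆ M i := by
  obtain ⟨s, rfl⟩ := ht.exists_finset_coe
  exact hM.directed_le.exists_mem_subset_of_finset_subset_biUnion h

theorem exists_le_encard_inter_of_monotone {ι : Type*} [Preorder ι] [IsDirectedOrder ι]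
    {M : ι → Set V} (hM : Monotone M) (j : ι) {E : Set V} {r : ℕ}
    (hr : r ≤ (E ∩ ⋃ i, M i).encard) : ∃ i, j ≤ i ∧ r ≤ (E ∩ M i).encard := by
  obtain ⟨t, htE, htr⟩ := exists_subset_encard_eq hr
  have : Nonempty ι := ⟨j⟩
  obtain ⟨i, hi⟩ := exists_subset_of_finite_of_subset_iUnion hM (finite_of_encard_eq_coe htr)
    fun x hx => (htE hx).2
  obtain ⟨k, hjk, hik⟩ := exists_ge_ge j i
  exact ⟨k, hjk, htr ▸ encard_le_encard (subset_inter (fun x hx => (htE hx).1)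
    (hi.trans (hM hik)))⟩

/-! ### Almost disjoint families -/

/-- Any two distinct members of the family have fewer than `r` points in common. This is the paper's
property `C(2, r)`; counting with `Set.encard` avoids a separate finiteness clause. -/
def AlmostDisjoint (𝓔 : Set (Set V)) (r : ℕ) : Prop :=
  𝓔.Pairwise fun E E' => (E ∩ E').encard < r

theorem PropertyC.almostDisjoint {𝓔 : Set (Set V)} {r : ℕ}
    (h : PropertyC 𝓔 2 (r : Cardinal.{u})) : AlmostDisjoint 𝓔 r := by
  intro E hE E' hE' hne
  have hlt : #(⋂₀ {E, E'} : Set V) < r := h {E, E'} (pair_subset hE hE') <| by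
    rw [mk_insert (by simpa using hne), mk_singleton, Nat.cast_ofNat, one_add_one_eq_two]
  rw [sInter_pair] at hlt
  have hfin : (E ∩ E').Finite := lt_aleph0_iff_set_finite.1 (hlt.trans natCast_lt_aleph0)
  rw [← hfin.cast_ncard_eq]
  rw [← cast_ncard hfin] at hlt
  exact_mod_cast hlt

namespace AlmostDisjoint

variable {𝓔 : Set (Set V)} {r : ℕ}

theorem finite_inter (hr : AlmostDisjoint 𝓔 r) {E E' : Set V} (hE : E ∈ 𝓔) (hE' : E' ∈ 𝓔)
    (hne : E ≠ E') : (E ∩ E').Finite :=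
  encard_lt_top_iff.1 ((hr hE hE' hne).trans_le le_top)

theorem mk_setOf_le_encard_inter_le (hr : AlmostDisjoint 𝓔 r) {κ : Cardinal.{u}} (hκ : ℵ₀ ≤ κ)
    {M : Set V} (hM : #M ≤ κ) : #{E ∈ 𝓔 | r ≤ (E ∩ M).encard} ≤ κ := by
  have hex : ∀ E : {E ∈ 𝓔 | r ≤ (E ∩ M).encard}, ∃ t ⊆ E.1 ∩ M, t.encard = r :=
    fun E => exists_subset_encard_eq E.2.2
  choose t htsub htcard using hex
  have hinj : Function.Injective t := by
    intro E E' htt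
    by_contra hne
    have hlt : (t E).encard < r := (encard_le_encard (subset_inter
      ((htsub E).trans inter_subset_left) (htt ▸ (htsub E').trans inter_subset_left))).trans_lt
      (hr E.2.1 E'.2.1 fun h => hne (Subtype.ext h))
    exact hlt.ne (htcard E)
  calc #{E ∈ 𝓔 | r ≤ (E ∩ M).encard} = #(range t) := (mk_range_eq t hinj).symm
    _ ≤ #{t : Set V | t.Finite ∧ t ⊆ M} := mk_le_mk_of_subset <| range_subset_iff.2 fun E =>
      ⟨finite_of_encard_eq_coe (htcard E), (htsub E).trans inter_subset_right⟩
    _ ≤ κ := mk_setOf_finite_subset_le hκ hM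

theorem mk_le (hr : AlmostDisjoint 𝓔 r) {κ : Cardinal.{u}} (hκ : ℵ₀ ≤ κ) {X : Set V}
    (hX : #X ≤ κ) (hsub : ∀ E ∈ 𝓔, E ⊆ X) : #𝓔 ≤ κ := by
  have hcov : 𝓔 ⊆ {E | E.Finite ∧ E ⊆ X} ∪ {E ∈ 𝓔 | r ≤ (E ∩ X).encard} := by
    intro E hE
    rcases E.finite_or_infinite with hfin | hinf
    · exact Or.inl ⟨hfin, hsub E hE⟩
    · refine Or.inr ⟨hE, ?_⟩
      rw [inter_eq_left.2 (hsub E hE), hinf.encard_eq]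
      exact le_top
  calc #𝓔 ≤ _ := mk_le_mk_of_subset hcov
    _ ≤ _ := mk_union_le _ _
    _ ≤ κ + κ := add_le_add (mk_setOf_finite_subset_le hκ hX)
      (hr.mk_setOf_le_encard_inter_le hκ hX)
    _ = κ := add_eq_self hκ

theorem mk_inter_sUnion_lt (hr : AlmostDisjoint 𝓔 r) {E : Set V} (hE : E ∈ 𝓔)
    (hinf : E.Infinite) {𝓛 : Set (Set V)} (h𝓛 : 𝓛 ⊆ 𝓔) (hE𝓛 : E ∉ 𝓛) (hlt : #𝓛 < #E) :
    #(E ∩ ⋃₀ 𝓛 : Set V) < #E := by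
  have hfin : ∀ T ∈ (E ∩ ·) '' 𝓛, T.Finite := by
    rintro _ ⟨L, hL, rfl⟩
    exact hr.finite_inter hE (h𝓛 hL) fun h => hE𝓛 (h ▸ hL)
  have heq : E ∩ ⋃₀ 𝓛 = ⋃₀ ((E ∩ ·) '' 𝓛) := by
    rw [sUnion_image, sUnion_eq_biUnion, inter_iUnion₂]
  rw [heq]
  rcases 𝓛.finite_or_infinite with h𝓛fin | h𝓛inf
  · exact mk_lt_mk_of_finite_of_infinite ((h𝓛fin.image _).sUnion hfin) hinf
  · have hℵ : ℵ₀ ≤ #𝓛 := aleph0_le_mk_of_infinite h𝓛inf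
    exact (mk_sUnion_le_of_le hℵ mk_image_le fun T hT =>
      (hfin T hT).lt_aleph0.le.trans hℵ).trans_lt hlt

theorem exists_closed_superset (hr : AlmostDisjoint 𝓔 r) {κ : Cardinal.{u}} (hκ : ℵ₀ ≤ κ)
    {M₀ : Set V} (hM₀ : #M₀ ≤ κ) :
    ∃ M, M₀ ⊆ M ∧ #M ≤ κ ∧ ∀ E ∈ 𝓔, #E ≤ κ → r ≤ (E ∩ M).encard → E ⊆ M := by
  let absorb : Set V → Set V := fun M => M ∪ ⋃₀ {E ∈ 𝓔 | #E ≤ κ ∧ r ≤ (E ∩ M).encard}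
  let M : ℕ → Set V := fun n => absorb^[n] M₀
  have hsucc : ∀ n, M (n + 1) = absorb (M n) := fun n => Function.iterate_succ_apply' _ _ _
  have hmono : Monotone M := monotone_nat_of_le_succ fun n => hsucc n ▸ subset_union_left
  have hcard : ∀ n, #(M n) ≤ κ := by
    intro n
    induction n with
    | zero => exact hM₀
    | succ n ih =>
      have hsub : {E ∈ 𝓔 | #E ≤ κ ∧ r ≤ (E ∩ M n).encard} ⊆ {E ∈ 𝓔 | r ≤ (E ∩ M n).encard} :=
        fun E hE => ⟨hE.1, hE.2.2⟩
      have hfew := (mk_le_mk_of_subset hsub).trans (hr.mk_setOf_le_encard_inter_le hκ ih)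
      rw [hsucc, ← add_eq_self hκ]
      exact (mk_union_le _ _).trans
        (add_le_add ih (mk_sUnion_le_of_le hκ hfew fun E hE => hE.2.1))
  refine ⟨⋃ n, M n, subset_iUnion M 0, ?_, fun E hE hEκ hrE => ?_⟩
  · rw [← sUnion_range]
    exact mk_sUnion_le_of_le hκ ((countable_range M).le_aleph0.trans hκ)
      (forall_mem_range.2 hcard)
  · obtain ⟨n, -, hn⟩ := exists_le_encard_inter_of_monotone hmono 0 hrE
    have hEn : E ⊆ M (n + 1) := by
      rw [hsucc]
      exact fun x hx => Or.inr ⟨E, ⟨hE, hEκ, hn⟩, hx⟩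
    exact hEn.trans (subset_iUnion M (n + 1))

end AlmostDisjoint

/-! ### Private edges -/

/-- A set that meets every edge and each of whose points is its only point in some edge. Such a set
is a minimal vertex cover, and private edges are easier to carry through a construction than
minimality. -/
structure IsPrivateCover (𝓔 : Set (Set V)) (Y : Set V) : Prop where
  inter_nonempty : ∀ E ∈ 𝓔, (Y ∩ E).Nonempty
  exists_private : ∀ y ∈ Y, ∃ E ∈ 𝓔, Y ∩ E = {y}

theorem mem_of_inter_eq_singleton {Y E : Set V} {y : V} (h : Y ∩ E = {y}) : y ∈ E :=
  (h.symm.subset rfl).2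

theorem IsPrivateCover.isMinimalVertexCover {𝓔 : Set (Set V)} {Y : Set V}
    (h : IsPrivateCover 𝓔 Y) : IsMinimalVertexCover 𝓔 Y := by
  refine ⟨⟨fun y hy => ?_, h.inter_nonempty⟩, fun Z hZY hZ => ?_⟩
  · obtain ⟨E, hE, hYE⟩ := h.exists_private y hy
    exact ⟨E, hE, mem_of_inter_eq_singleton hYE⟩
  · obtain ⟨y, hy, hyZ⟩ := exists_of_ssubset hZY
    obtain ⟨E, hE, hYE⟩ := h.exists_private y hy
    obtain ⟨z, hzZ, hzE⟩ := hZ.2 E hE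
    have hzy : z = y := hYE.subset ⟨hZY.1 hzZ, hzE⟩
    exact hyZ (hzy ▸ hzZ)

/-! ### Partial choices -/

/-- A partial function from `V` to `{0, 1}`, given by its domain `decided` and the set `chosen` of
the points that it maps to `1`. It describes a state in the construction of a vertex cover. -/
@[ext]
structure PartialChoice (V : Type u) where
  /-- The points selected for the cover. -/
  chosen : Set V
  /-- The points on which the decision has been taken. -/
  decided : Set V
  chosen_subset : chosen ⊆ decided

namespace PartialChoice

/-- Extension of partial functions. -/
instance : PartialOrder (PartialChoice V) where
  le p q := p.decided ⊆ q.decided ∧ q.chosen ∩ p.decided = p.chosen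
  le_refl p := ⟨subset_rfl, inter_eq_left.2 p.chosen_subset⟩
  le_trans p q w hpq hqw := ⟨hpq.1.trans hqw.1, by
    rw [← hpq.2, ← hqw.2, inter_assoc, inter_eq_right.2 hpq.1]⟩
  le_antisymm p q hpq hqp := by
    have hdecided := hpq.1.antisymm hqp.1
    refine PartialChoice.ext ?_ hdecided
    rw [← hpq.2, hdecided, inter_eq_left.2 q.chosen_subset]

variable {p q : PartialChoice V}

theorem decided_subset_of_le (h : p ≤ q) : p.decided ⊆ q.decided :=
  h.1

theorem chosen_inter_of_le (h : p ≤ q) {E : Set V} (hE : E ⊆ p.decided) :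
    q.chosen ∩ E = p.chosen ∩ E := by
  rw [← h.2, inter_assoc, inter_eq_right.2 hE]

theorem chosen_subset_of_le (h : p ≤ q) : p.chosen ⊆ q.chosen :=
  h.2.symm.subset.trans inter_subset_left

theorem disjoint_chosen_of_le (h : p ≤ q) {E : Set V} (hE : Disjoint E q.chosen) :
    Disjoint E p.chosen :=
  hE.mono_right (chosen_subset_of_le h)

/-- Decide the points of `M`, too, by selecting those in `Z`. -/
def adjoin (p : PartialChoice V) {Z M : Set V} (hZ : Z ⊆ M) : PartialChoice V where
  chosen := p.chosen ∪ Z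
  decided := p.decided ∪ M
  chosen_subset := union_subset_union p.chosen_subset hZ

theorem le_adjoin {Z M : Set V} (hZ : Z ⊆ M) (hdis : Disjoint Z p.decided) : p ≤ p.adjoin hZ := by
  refine ⟨subset_union_left, ?_⟩
  change (p.chosen ∪ Z) ∩ p.decided = p.chosen
  rw [union_inter_distrib_right, hdis.inter_eq, union_empty, inter_eq_left.2 p.chosen_subset]

/-- The common extension of a chain of partial choices. -/
protected def iUnion {ι : Type*} (f : ι → PartialChoice V) : PartialChoice V where
  chosen := ⋃ i, (f i).chosen
  decided := ⋃ i, (f i).decided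
  chosen_subset := iUnion_mono fun i => (f i).chosen_subset

theorem le_iUnion {ι : Type*} [LinearOrder ι] {f : ι → PartialChoice V} (hf : Monotone f) (i : ι) :
    f i ≤ PartialChoice.iUnion f := by
  refine ⟨subset_iUnion (fun j => (f j).decided) i, Subset.antisymm ?_ ?_⟩
  · rintro x ⟨hx, hxi⟩
    obtain ⟨j, hj⟩ := mem_iUnion.1 hx
    rcases le_total i j with hij | hji
    · exact (hf hij).2.subset ⟨hj, hxi⟩
    · exact chosen_subset_of_le (hf hji) hj
  · exact fun x hx => ⟨mem_iUnion.2 ⟨i, hx⟩, (f i).chosen_subset hx⟩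

end PartialChoice

/-! ### Partial covers -/

/-- The undecided parts of the finite edges without chosen points. -/
def finiteTraces (𝓔 : Set (Set V)) (p : PartialChoice V) : Set (Set V) :=
  (· \ p.decided) '' {F ∈ 𝓔 | F.Finite ∧ Disjoint F p.chosen}

/-- The set `E` contains the undecided part of a finite edge without chosen points, so that `E` will
be met as soon as this finite edge is. -/
def ContainsFiniteTrace (𝓔 : Set (Set V)) (p : PartialChoice V) (E : Set V) : Prop :=
  ∃ T ∈ finiteTraces 𝓔 p, T ⊆ E

theorem ContainsFiniteTrace.mono {𝓔 : Set (Set V)} {p q : PartialChoice V} {E : Set V}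
    (h : ContainsFiniteTrace 𝓔 p E) (hpq : p ≤ q) (hE : Disjoint E q.chosen) :
    ContainsFiniteTrace 𝓔 q E := by
  obtain ⟨_, ⟨F, ⟨hF, hfin, hdis⟩, rfl⟩, hsub⟩ := h
  refine ⟨_, ⟨F, ⟨hF, hfin, disjoint_left.2 fun x hxF hxq => ?_⟩, rfl⟩,
    (sdiff_subset_sdiff_right hpq.1).trans hsub⟩
  by_cases hxp : x ∈ p.decided
  · exact disjoint_left.1 hdis hxF (hpq.2.subset ⟨hxq, hxp⟩)
  · exact disjoint_left.1 hE (hsub ⟨hxF, hxp⟩) hxq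

theorem exists_minimal_finiteTrace {𝓔 : Set (Set V)} {p : PartialChoice V} {T : Set V}
    (hT : T ∈ finiteTraces 𝓔 p) : ∃ T' ⊆ T, Minimal (· ∈ finiteTraces 𝓔 p) T' := by
  have hTfin : T.Finite := by
    obtain ⟨F, ⟨-, hfin, -⟩, rfl⟩ := hT
    exact hfin.sdiff
  obtain ⟨T', hT'T, hmin⟩ :=
    (hTfin.finite_subsets.inter_of_left (finiteTraces 𝓔 p)).exists_le_minimal
      ⟨(subset_rfl : T ⊆ T), hT⟩
  exact ⟨T', hT'T, hmin.prop.2, fun U hU hUT' => hmin.le_of_le ⟨hUT'.trans hT'T, hU⟩ hUT'⟩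

/-- A partial choice with a private edge, inside the decided points, for each chosen point, and for
which every edge without chosen points can still be met. -/
structure IsPartialCover (𝓔 : Set (Set V)) (p : PartialChoice V) : Prop where
  exists_private : ∀ y ∈ p.chosen, ∃ E ∈ 𝓔, E ⊆ p.decided ∧ p.chosen ∩ E = {y}
  not_subset_of_finite : ∀ E ∈ 𝓔, E.Finite → Disjoint E p.chosen → ¬ E ⊆ p.decided
  mk_inter_lt_or_trace : ∀ E ∈ 𝓔, E.Infinite → Disjoint E p.chosen →
    #(E ∩ p.decided : Set V) < #E ∨ ContainsFiniteTrace 𝓔 p E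

namespace IsPartialCover

variable {𝓔 : Set (Set V)} {p q : PartialChoice V}

theorem exists_private_of_le (h : IsPartialCover 𝓔 p) (hpq : p ≤ q) {y : V} (hy : y ∈ p.chosen) :
    ∃ E ∈ 𝓔, E ⊆ q.decided ∧ q.chosen ∩ E = {y} := by
  obtain ⟨E, hE, hEp, hyE⟩ := h.exists_private y hy
  exact ⟨E, hE, hEp.trans hpq.1, (PartialChoice.chosen_inter_of_le hpq hEp).trans hyE⟩

theorem mk_inter_lt_or_trace_of_le (h : IsPartialCover 𝓔 p) (hpq : p ≤ q) {E : Set V} (hE : E ∈ 𝓔)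
    (hinf : E.Infinite) (hdis : Disjoint E q.chosen) :
    #(E ∩ p.decided : Set V) < #E ∨ ContainsFiniteTrace 𝓔 q E :=
  (h.mk_inter_lt_or_trace E hE hinf (PartialChoice.disjoint_chosen_of_le hpq hdis)).imp_right
    fun htrace => htrace.mono hpq hdis

theorem adjoin (h : IsPartialCover 𝓔 p) {Z M : Set V} (hZ : Z ⊆ M) (hdis : Disjoint Z p.decided)
    (hprivate : ∀ z ∈ Z, ∃ E ∈ 𝓔, E ⊆ p.decided ∪ M ∧ (p.chosen ∪ Z) ∩ E = {z})
    (hfinite : ∀ E ∈ 𝓔, E.Finite → Disjoint E (p.chosen ∪ Z) → ¬ E ⊆ p.decided ∪ M)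
    (hinfinite : ∀ E ∈ 𝓔, E.Infinite → Disjoint E (p.chosen ∪ Z) → #(E ∩ M : Set V) < #E) :
    IsPartialCover 𝓔 (p.adjoin hZ) where
  exists_private := by
    rintro y (hy | hy)
    · exact h.exists_private_of_le (PartialChoice.le_adjoin hZ hdis) hy
    · exact hprivate y hy
  not_subset_of_finite := hfinite
  mk_inter_lt_or_trace E hE hinf hEdis :=
    (h.mk_inter_lt_or_trace_of_le (PartialChoice.le_adjoin hZ hdis) hE hinf hEdis).imp_left
      fun hlt => mk_inter_union_lt hinf hlt (hinfinite E hE hinf hEdis)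

theorem adjoin_singleton {r : ℕ} (hr : AlmostDisjoint 𝓔 r) (h : IsPartialCover 𝓔 p) {F : Set V}
    (hF : F ∈ 𝓔) (hdis : Disjoint F p.chosen) {y : V} (hyF : y ∈ F) (hyp : y ∉ p.decided)
    (hfinite : ∀ E ∈ 𝓔, E.Finite → Disjoint E p.chosen → E \ p.decided ⊆ F → y ∈ E) :
    IsPartialCover 𝓔 (p.adjoin (singleton_subset_iff.2 hyF)) := by
  refine h.adjoin _ (disjoint_singleton_left.2 hyp) ?_ ?_ ?_
  · rintro z rfl
    refine ⟨F, hF, subset_union_right, ?_⟩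
    rw [union_inter_distrib_right, hdis.symm.inter_eq, empty_union,
      singleton_inter_of_mem hyF]
  · intro E hE hfin hEdis hsub
    rw [disjoint_union_right, disjoint_singleton_right] at hEdis
    exact hEdis.2 (hfinite E hE hfin hEdis.1 (sdiff_subset_iff.2 hsub))
  · intro E hE hinf hEdis
    rw [disjoint_union_right, disjoint_singleton_right] at hEdis
    exact mk_lt_mk_of_finite_of_infinite
      (hr.finite_inter hE hF fun h => hEdis.2 (h ▸ hyF)) hinf

end IsPartialCover

/-- The undecided parts of the edges without chosen points, except for those infinite edges most of
which has been decided. Covers of this hypergraph extend the partial choice. -/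
def residual (𝓔 : Set (Set V)) (p : PartialChoice V) : Set (Set V) :=
  (· \ p.decided) '' {E | E ∈ 𝓔 ∧ Disjoint E p.chosen ∧
    (E.Infinite → #(E ∩ p.decided : Set V) < #E)}

section Residual

variable {𝓔 : Set (Set V)} {p : PartialChoice V}

theorem finiteTraces_subset_residual : finiteTraces 𝓔 p ⊆ residual 𝓔 p :=
  image_mono fun _ hF => ⟨hF.1, hF.2.2, fun hinf => absurd hF.2.1 hinf⟩

theorem IsPartialCover.nonempty_of_mem_residual (h : IsPartialCover 𝓔 p) {H : Set V}
    (hH : H ∈ residual 𝓔 p) : H.Nonempty := by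
  obtain ⟨E, ⟨hE, hdis, hlt⟩, rfl⟩ := hH
  rw [sdiff_nonempty]
  intro hsub
  rcases E.finite_or_infinite with hfin | hinf
  · exact h.not_subset_of_finite E hE hfin hdis hsub
  · have hlt' := hlt hinf
    rw [inter_eq_left.2 hsub] at hlt'
    exact hlt'.false

theorem IsPartialCover.exists_mem_residual_subset (h : IsPartialCover 𝓔 p) {E : Set V}
    (hE : E ∈ 𝓔) (hdis : Disjoint E p.chosen) : ∃ H ∈ residual 𝓔 p, H ⊆ E \ p.decided := by
  rcases E.finite_or_infinite with hfin | hinf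
  · exact ⟨_, finiteTraces_subset_residual ⟨E, ⟨hE, hfin, hdis⟩, rfl⟩, subset_rfl⟩
  rcases h.mk_inter_lt_or_trace E hE hinf hdis with hlt | ⟨T, hT, hTE⟩
  · exact ⟨_, ⟨E, ⟨hE, hdis, fun _ => hlt⟩, rfl⟩, subset_rfl⟩
  · refine ⟨T, finiteTraces_subset_residual hT, subset_sdiff.2 ⟨hTE, ?_⟩⟩
    obtain ⟨F, -, rfl⟩ := hT
    exact disjoint_sdiff_left

theorem IsPartialCover.diff_decided_nonempty (h : IsPartialCover 𝓔 p) {E : Set V} (hE : E ∈ 𝓔)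
    (hdis : Disjoint E p.chosen) : (E \ p.decided).Nonempty := by
  obtain ⟨H, hH, hHE⟩ := h.exists_mem_residual_subset hE hdis
  exact (h.nonempty_of_mem_residual hH).mono hHE

theorem mk_mem_of_mem_residual {S : Set Cardinal.{u}} (hS : ∀ E ∈ 𝓔, E.Infinite → #E ∈ S)
    {H : Set V} (hH : H ∈ residual 𝓔 p) (hinf : H.Infinite) : #H ∈ S := by
  obtain ⟨E, ⟨hE, -, hlt⟩, rfl⟩ := hH
  have hEinf : E.Infinite := hinf.mono sdiff_subset
  exact (mk_diff_eq_of_mk_inter_lt hEinf (hlt hEinf)).symm ▸ hS E hE hEinf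

theorem AlmostDisjoint.residual {r : ℕ} (hr : AlmostDisjoint 𝓔 r) :
    AlmostDisjoint (residual 𝓔 p) r := by
  rintro _ ⟨E, hE, rfl⟩ _ ⟨E', hE', rfl⟩ hne
  exact (encard_le_encard (inter_subset_inter sdiff_subset sdiff_subset)).trans_lt
    (hr hE.1 hE'.1 fun h => hne (congrArg (· \ p.decided) h))

end Residual

/-- The private edge of the new point is chosen as a finite edge with a minimal trace if possible,
and otherwise as a small infinite edge without finite traces; only the last resort is `L` itself. -/
theorem IsPartialCover.exists_adjoin_singleton {𝓔 : Set (Set V)} {p : PartialChoice V} {r : ℕ}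
    (hr : AlmostDisjoint 𝓔 r) (h : IsPartialCover 𝓔 p) {L : Set V} (hL : L ∈ 𝓔)
    (hdis : Disjoint L p.chosen) {θ : Cardinal.{u}} (hθ : ℵ₀ ≤ θ) :
    ∃ y ∈ L, y ∉ p.decided ∧ ∃ F ∈ 𝓔, ∃ hyF : y ∈ F,
      IsPartialCover 𝓔 (p.adjoin (singleton_subset_iff.2 hyF)) ∧
      (#F < θ ∨ ∀ E ∈ 𝓔, E.Infinite → #E < θ → Disjoint E p.chosen →
        E ∩ F ⊆ p.decided ∨ ContainsFiniteTrace 𝓔 p E) := by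
  by_cases htrace : ∃ T, Minimal (· ∈ finiteTraces 𝓔 p) T ∧ (L ∩ T).Nonempty
  · obtain ⟨T, hmin, y, hyL, hyT⟩ := htrace
    obtain ⟨F, ⟨hF, hFfin, hFdis⟩, rfl⟩ := hmin.prop
    refine ⟨y, hyL, hyT.2, F, hF, hyT.1, h.adjoin_singleton hr hF hFdis hyT.1 hyT.2 ?_,
      Or.inl (hFfin.lt_aleph0.trans_le hθ)⟩
    intro E hE hEfin hEdis hEF
    have hsub : E \ p.decided ⊆ F \ p.decided := fun x hx => ⟨hEF hx, hx.2⟩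
    exact (hmin.le_of_le ⟨E, ⟨hE, hEfin, hEdis⟩, rfl⟩ hsub hyT).1
  by_cases hsmall : ∃ E ∈ 𝓔, E.Infinite ∧ #E < θ ∧ Disjoint E p.chosen ∧ ¬ E ∩ L ⊆ p.decided ∧
      ¬ ContainsFiniteTrace 𝓔 p E
  · obtain ⟨F, hF, -, hFθ, hFdis, hFL, hFtrace⟩ := hsmall
    obtain ⟨y, ⟨hyF, hyL⟩, hyp⟩ := not_subset.1 hFL
    refine ⟨y, hyL, hyp, F, hF, hyF, h.adjoin_singleton hr hF hFdis hyF hyp ?_, Or.inl hFθ⟩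
    intro E hE hEfin hEdis hEF
    exact absurd ⟨_, ⟨E, ⟨hE, hEfin, hEdis⟩, rfl⟩, hEF⟩ hFtrace
  obtain ⟨y, hyL, hyp⟩ := h.diff_decided_nonempty hL hdis
  refine ⟨y, hyL, hyp, L, hL, hyL, h.adjoin_singleton hr hL hdis hyL hyp ?_, Or.inr ?_⟩
  · intro E hE hEfin hEdis hEL
    obtain ⟨T, hTE, hmin⟩ := exists_minimal_finiteTrace ⟨E, ⟨hE, hEfin, hEdis⟩, rfl⟩
    obtain ⟨x, hx⟩ := h.nonempty_of_mem_residual (finiteTraces_subset_residual hmin.prop)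
    exact absurd ⟨T, hmin, x, hEL (hTE hx), hx⟩ htrace
  · intro E hE hinf hEθ hEdis
    by_contra! hE'
    exact hsmall ⟨E, hE, hinf, hEθ, hEdis, hE'⟩

/-! ### Closing off -/

/-- Every partial cover can be extended by fewer than `θ` decided points, containing any given
decided set of size less than `θ`, so as to meet each edge of size less than `θ` with at least `r`
of these points. -/
def Extendable (𝓔 : Set (Set V)) (r : ℕ) (θ : Cardinal.{u}) : Prop :=
  ∀ p : PartialChoice V, IsPartialCover 𝓔 p → ∀ M₀ ⊆ p.decided, #M₀ < θ →
    ∃ (q : PartialChoice V) (M : Set V), p ≤ q ∧ q.decided = p.decided ∪ M ∧ M₀ ⊆ M ∧ #M < θ ∧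
      IsPartialCover 𝓔 q ∧
      ∀ E ∈ 𝓔, E.Infinite → #E < θ → r ≤ (E ∩ M).encard → ¬ Disjoint E q.chosen

theorem extendable_aleph0 (𝓔 : Set (Set V)) (r : ℕ) : Extendable 𝓔 r ℵ₀ := by
  intro p hp M₀ hM₀ hcard
  refine ⟨p, M₀, le_rfl, (union_eq_left.2 hM₀).symm, subset_rfl, hcard, hp, ?_⟩
  exact fun E _ hinf hlt => absurd (lt_aleph0_iff_set_finite.1 hlt) hinf

section Residual

variable {𝓔 : Set (Set V)} {p : PartialChoice V} {Z M : Set V}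

theorem IsPrivateCover.subset_diff_decided
    (hZ : IsPrivateCover {H ∈ residual 𝓔 p | H ⊆ M} Z) : Z ⊆ M \ p.decided := by
  intro z hz
  obtain ⟨_, ⟨⟨E, -, rfl⟩, hEM⟩, hZE⟩ := hZ.exists_private z hz
  have hzE := mem_of_inter_eq_singleton hZE
  exact ⟨hEM hzE, hzE.2⟩

theorem IsPrivateCover.not_disjoint_of_residual
    (hZ : IsPrivateCover {H ∈ residual 𝓔 p | H ⊆ M} Z) (hp : IsPartialCover 𝓔 p) {E : Set V}
    (hE : E ∈ 𝓔) (hEM : E ⊆ p.decided ∪ M) : ¬ Disjoint E (p.chosen ∪ Z) := by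
  intro hdis
  rw [disjoint_union_right] at hdis
  obtain ⟨H, hH, hHE⟩ := hp.exists_mem_residual_subset hE hdis.1
  obtain ⟨z, hzZ, hzH⟩ := hZ.inter_nonempty H ⟨hH, hHE.trans (sdiff_subset_iff.2 hEM)⟩
  exact disjoint_left.1 hdis.2 (hHE hzH).1 hzZ

theorem IsPrivateCover.exists_private_of_residual
    (hZ : IsPrivateCover {H ∈ residual 𝓔 p | H ⊆ M} Z) {z : V} (hz : z ∈ Z) :
    ∃ E ∈ 𝓔, E ⊆ p.decided ∪ M ∧ (p.chosen ∪ Z) ∩ E = {z} := by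
  obtain ⟨_, ⟨⟨E, ⟨hE, hdis, -⟩, rfl⟩, hEM⟩, hZE⟩ := hZ.exists_private z hz
  refine ⟨E, hE, sdiff_subset_iff.1 hEM, ?_⟩
  have hZp : Disjoint Z p.decided := (subset_sdiff.1 hZ.subset_diff_decided).2
  rw [union_inter_distrib_right, hdis.symm.inter_eq, empty_union, ← hZE, ← inter_sdiff_assoc,
    inter_sdiff_right_comm, hZp.sdiff_eq_left]

theorem extendable_succ {r : ℕ} (hr : AlmostDisjoint 𝓔 r) {κ : Cardinal.{u}} (hκ : ℵ₀ ≤ κ)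
    (hcover : ∀ (p : PartialChoice V) (M : Set V), IsPartialCover 𝓔 p → #M ≤ κ →
      ∃ Z, IsPrivateCover {H ∈ residual 𝓔 p | H ⊆ M} Z) :
    Extendable 𝓔 r (Order.succ κ) := by
  intro p hp M₀ _ hcard
  obtain ⟨M, hM₀M, hMκ, hclosed⟩ := hr.exists_closed_superset hκ (Order.lt_succ_iff.1 hcard)
  obtain ⟨Z, hZ⟩ := hcover p M hp hMκ
  obtain ⟨hZM, hZp⟩ := subset_sdiff.1 hZ.subset_diff_decided
  have hmeets : ∀ E ∈ 𝓔, #E ≤ κ → r ≤ (E ∩ M).encard → ¬ Disjoint E (p.chosen ∪ Z) :=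
    fun E hE hEκ hrE => hZ.not_disjoint_of_residual hp hE
      ((hclosed E hE hEκ hrE).trans subset_union_right)
  refine ⟨p.adjoin hZM, M, PartialChoice.le_adjoin hZM hZp, rfl, hM₀M, Order.lt_succ_iff.2 hMκ,
    hp.adjoin hZM hZp (fun z hz => hZ.exists_private_of_residual hz) ?_ ?_,
    fun E hE _ hEκ => hmeets E hE (Order.lt_succ_iff.1 hEκ)⟩
  · exact fun E hE _ hdis hEM => hZ.not_disjoint_of_residual hp hE hEM hdis
  · intro E hE hinf hdis
    rcases le_or_gt #E κ with hEκ | hEκ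
    · have hfew : (E ∩ M).encard < r := not_le.1 fun hle => hmeets E hE hEκ hle hdis
      exact mk_lt_mk_of_finite_of_infinite (encard_lt_top_iff.1 (hfew.trans_le le_top)) hinf
    · exact ((mk_le_mk_of_subset inter_subset_right).trans hMκ).trans_lt hEκ

end Residual

/-! ### Stages of the construction -/

/-- A partial choice together with a decomposition of the decided points into a small set and the
union of few edges. The cardinality bounds are part of `Stage.IsAdmissible`. -/
structure Stage (V : Type u) extends PartialChoice V where
  /-- The small part of the decided points. -/
  core : Set V
  /-- The edges which, together with the core, make up the decided points. -/
  large : Set (Set V)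
  decided_eq : decided = core ∪ ⋃₀ large

namespace Stage

/-- The properties of a stage that are kept throughout the construction, relative to the size `θ`
below which the core is to be handled. -/
structure IsAdmissible (𝓔 : Set (Set V)) (θ : Cardinal.{u}) (s : Stage V) : Prop where
  partialCover : IsPartialCover 𝓔 s.toPartialChoice
  large_subset : s.large ⊆ 𝓔
  large_meets : ∀ E ∈ s.large, ¬ Disjoint E s.chosen
  core_lt : #s.core < θ
  large_lt : #s.large < θ

/-- The closing-off condition: infinite edges of size less than `θ` with at least `r` points in the
core have been met. It is lost at limits and therefore kept apart from `Stage.IsAdmissible`. -/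
def MeetsCore (𝓔 : Set (Set V)) (r : ℕ) (θ : Cardinal.{u}) (s : Stage V) : Prop :=
  ∀ E ∈ 𝓔, E.Infinite → #E < θ → r ≤ (E ∩ s.core).encard → ¬ Disjoint E s.chosen

/-- The stage `t` continues the stage `s`, and on infinite edges of size less than `θ` that need
attention only points of the core have been newly decided. -/
structure Extends (𝓔 : Set (Set V)) (θ : Cardinal.{u}) (s t : Stage V) : Prop where
  le : s.toPartialChoice ≤ t.toPartialChoice
  core_subset : s.core ⊆ t.core
  large_subset : s.large ⊆ t.large
  inter_decided : ∀ E ∈ 𝓔, E.Infinite → #E < θ → Disjoint E t.chosen →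
    E ∩ t.decided ⊆ s.decided ∪ t.core ∨ ContainsFiniteTrace 𝓔 t.toPartialChoice E

variable {𝓔 : Set (Set V)} {r : ℕ} {θ : Cardinal.{u}} {s t w : Stage V}

theorem Extends.refl (𝓔 : Set (Set V)) (θ : Cardinal.{u}) (s : Stage V) : s.Extends 𝓔 θ s where
  le := le_rfl
  core_subset := subset_rfl
  large_subset := subset_rfl
  inter_decided _ _ _ _ _ := Or.inl (inter_subset_right.trans subset_union_left)

theorem Extends.trans {θ' : Cardinal.{u}} (h : s.Extends 𝓔 θ t) (h' : t.Extends 𝓔 θ' w)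
    (hθ : θ ≤ θ') : s.Extends 𝓔 θ w where
  le := h.le.trans h'.le
  core_subset := h.core_subset.trans h'.core_subset
  large_subset := h.large_subset.trans h'.large_subset
  inter_decided E hE hinf hEθ hdis := by
    rcases h'.inter_decided E hE hinf (hEθ.trans_le hθ) hdis with hEw | hEw
    swap
    · exact Or.inr hEw
    refine (h.inter_decided E hE hinf hEθ
      (PartialChoice.disjoint_chosen_of_le h'.le hdis)).imp (fun hEt x hx => ?_)
      fun hEt => hEt.mono h'.le hdis
    rcases hEw hx with hxt | hxw
    · exact (hEt ⟨hx.1, hxt⟩).imp_right (@h'.core_subset x)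
    · exact Or.inr hxw

theorem IsAdmissible.large_meets_of_le (hs : s.IsAdmissible 𝓔 θ) {q : PartialChoice V}
    (hq : s.toPartialChoice ≤ q) {E : Set V} (hE : E ∈ s.large) : ¬ Disjoint E q.chosen :=
  fun hdis => hs.large_meets E hE (PartialChoice.disjoint_chosen_of_le hq hdis)

theorem IsAdmissible.exists_extends_meets (hr : AlmostDisjoint 𝓔 r) (hθ : ℵ₀ ≤ θ)
    (hs : s.IsAdmissible 𝓔 θ) {L : Set V} (hL : L ∈ 𝓔) :
    ∃ t : Stage V, t.IsAdmissible 𝓔 θ ∧ s.Extends 𝓔 θ t ∧ ¬ Disjoint L t.chosen := by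
  by_cases hdis : Disjoint L s.chosen
  swap
  · exact ⟨s, hs, .refl _ _ _, hdis⟩
  obtain ⟨y, hyL, hyp, F, hF, hyF, hcover, hsmall⟩ :=
    hs.partialCover.exists_adjoin_singleton hr hL hdis hθ
  have hle := PartialChoice.le_adjoin (singleton_subset_iff.2 hyF) (disjoint_singleton_left.2 hyp)
  by_cases hFθ : #F < θ
  · refine ⟨⟨s.adjoin (singleton_subset_iff.2 hyF), s.core ∪ F, s.large, ?_⟩,
      ⟨hcover, hs.large_subset, fun _ => hs.large_meets_of_le hle,
        mk_union_lt hθ hs.core_lt hFθ, hs.large_lt⟩,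
      ⟨hle, subset_union_left, subset_rfl, fun E _ _ _ _ => Or.inl ?_⟩,
      not_disjoint_iff.2 ⟨y, hyL, Or.inr rfl⟩⟩
    · rw [union_right_comm, ← s.decided_eq]
      rfl
    · exact inter_subset_right.trans (union_subset_union_right _ subset_union_right)
  · refine ⟨⟨s.adjoin (singleton_subset_iff.2 hyF), s.core, insert F s.large, ?_⟩,
      ⟨hcover, insert_subset hF hs.large_subset, ?_, hs.core_lt, ?_⟩,
      ⟨hle, subset_rfl, subset_insert _ _, ?_⟩, not_disjoint_iff.2 ⟨y, hyL, Or.inr rfl⟩⟩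
    · rw [sUnion_insert, union_left_comm, ← s.decided_eq, union_comm]
      rfl
    · rintro E (rfl | hE)
      · exact not_disjoint_iff.2 ⟨y, hyF, Or.inr rfl⟩
      · exact hs.large_meets_of_le hle hE
    · exact mk_insert_le.trans_lt (add_lt_of_lt hθ hs.large_lt (one_lt_aleph0.trans_le hθ))
    · intro E hE hinf hEθ hEdis
      refine ((hsmall.resolve_left hFθ) E hE hinf hEθ
        (PartialChoice.disjoint_chosen_of_le hle hEdis)).imp ?_ fun h => h.mono hle hEdis
      rintro hEF x ⟨hxE, hx | hx⟩
      · exact Or.inl hx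
      · exact Or.inl (hEF ⟨hxE, hx⟩)

theorem IsAdmissible.exists_extends_meetsCore (hext : Extendable 𝓔 r θ)
    (hs : s.IsAdmissible 𝓔 θ) :
    ∃ t : Stage V, t.IsAdmissible 𝓔 θ ∧ t.MeetsCore 𝓔 r θ ∧ s.Extends 𝓔 θ t := by
  have hcore : s.core ⊆ s.decided := by
    rw [s.decided_eq]
    exact subset_union_left
  obtain ⟨q, M, hle, hdecided, hM, hMθ, hcover, hmeets⟩ := hext _ hs.partialCover _ hcore hs.core_lt
  refine ⟨⟨q, M, s.large, ?_⟩, ⟨hcover, hs.large_subset, fun _ => hs.large_meets_of_le hle, hMθ,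
    hs.large_lt⟩, hmeets, ⟨hle, hM, subset_rfl, fun _ _ _ _ _ => Or.inl ?_⟩⟩
  · rw [hdecided, s.decided_eq, union_right_comm, union_eq_right.2 hM]
  · exact inter_subset_right.trans hdecided.subset

theorem IsAdmissible.exists_extends (hr : AlmostDisjoint 𝓔 r) (hθ : ℵ₀ ≤ θ)
    (hext : Extendable 𝓔 r θ) (hs : s.IsAdmissible 𝓔 θ) {L : Set V} (hL : L ∈ 𝓔) :
    ∃ t : Stage V, t.IsAdmissible 𝓔 θ ∧ t.MeetsCore 𝓔 r θ ∧ s.Extends 𝓔 θ t ∧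
      ¬ Disjoint L t.chosen := by
  obtain ⟨t, ht, hst, hLt⟩ := hs.exists_extends_meets hr hθ hL
  obtain ⟨w, hw, hwcore, htw⟩ := ht.exists_extends_meetsCore hext
  exact ⟨w, hw, hwcore, hst.trans htw le_rfl,
    fun hdis => hLt (PartialChoice.disjoint_chosen_of_le htw.le hdis)⟩

/-- The union of a family of stages, which is meaningful for chains. -/
protected def iUnion {ι : Type*} (f : ι → Stage V) : Stage V where
  toPartialChoice := .iUnion fun i => (f i).toPartialChoice
  core := ⋃ i, (f i).core
  large := ⋃ i, (f i).large
  decided_eq := by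
    rw [sUnion_iUnion, ← iUnion_union_distrib]
    exact iUnion_congr fun i => (f i).decided_eq

section Chain

variable {ι : Type*} [LinearOrder ι] {θ : ι → Cardinal.{u}} {f : ι → Stage V}

theorem extends_iUnion (hf : ∀ i j, i ≤ j → (f i).Extends 𝓔 (θ i) (f j)) (i : ι) :
    (f i).Extends 𝓔 (θ i) (Stage.iUnion f) := by
  have hle : ∀ j, (f j).toPartialChoice ≤ (Stage.iUnion f).toPartialChoice :=
    PartialChoice.le_iUnion fun j k hjk => (hf j k hjk).le
  refine ⟨hle i, subset_iUnion (fun j => (f j).core) i, subset_iUnion (fun j => (f j).large) i,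
    fun E hE hinf hEθ hdis => or_iff_not_imp_right.2 fun htrace => ?_⟩
  rintro x ⟨hxE, hx⟩
  obtain ⟨k, hk⟩ := mem_iUnion.1 hx
  rcases le_total k i with hki | hik
  · exact Or.inl (PartialChoice.decided_subset_of_le (hf k i hki).le hk)
  · rcases (hf i k hik).inter_decided E hE hinf hEθ
      (PartialChoice.disjoint_chosen_of_le (hle k) hdis) with hEk | hEk
    · exact (hEk ⟨hxE, hk⟩).imp_right fun hxk => mem_iUnion.2 ⟨k, hxk⟩
    · exact absurd (hEk.mono (hle k) hdis) htrace

theorem not_subset_iUnion_of_finite (hf : ∀ i j, i ≤ j → (f i).Extends 𝓔 (θ i) (f j))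
    (hadm : ∀ i, (f i).IsAdmissible 𝓔 (θ i)) {E : Set V} (hE : E ∈ 𝓔) (hne : E.Nonempty)
    (hfin : E.Finite) (hdis : Disjoint E (Stage.iUnion f).chosen) :
    ¬ E ⊆ (Stage.iUnion f).decided := by
  intro hsub
  have : Nonempty ι := by
    obtain ⟨x, hx⟩ := hne
    obtain ⟨i, -⟩ := mem_iUnion.1 (hsub hx)
    exact ⟨i⟩
  have hmono : Monotone fun i => (f i).decided :=
    fun i j hij => PartialChoice.decided_subset_of_le (hf i j hij).le
  obtain ⟨i, hi⟩ := exists_subset_of_finite_of_subset_iUnion hmono hfin hsub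
  exact (hadm i).partialCover.not_subset_of_finite E hE hfin
    (PartialChoice.disjoint_chosen_of_le (extends_iUnion hf i).le hdis) hi

theorem mk_inter_iUnion_lt_or_trace (hθ : Monotone θ)
    (hf : ∀ i j, i ≤ j → (f i).Extends 𝓔 (θ i) (f j)) (hadm : ∀ i, (f i).IsAdmissible 𝓔 (θ i))
    (hmeets : ∀ i, (f i).MeetsCore 𝓔 r (θ i)) {E : Set V} (hE : E ∈ 𝓔) (hinf : E.Infinite)
    (hdis : Disjoint E (Stage.iUnion f).chosen) {i : ι} (hi : #E < θ i) :
    #(E ∩ (Stage.iUnion f).decided : Set V) < #E ∨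
      ContainsFiniteTrace 𝓔 (Stage.iUnion f).toPartialChoice E := by
  have hU := extends_iUnion hf
  rcases (hU i).inter_decided E hE hinf hi hdis with hnew | htrace
  swap
  · exact Or.inr htrace
  refine ((hadm i).partialCover.mk_inter_lt_or_trace_of_le (hU i).le hE hinf hdis).imp_left
    fun hold => ?_
  have hcore : (E ∩ (Stage.iUnion f).core).encard < r := by
    by_contra! hle
    obtain ⟨k, hik, hk⟩ := exists_le_encard_inter_of_monotone
      (fun j k hjk => (hf j k hjk).core_subset) i hle
    exact hmeets k E hE hinf (hi.trans_le (hθ hik)) hk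
      (PartialChoice.disjoint_chosen_of_le (hU k).le hdis)
  have hcore_lt : #(E ∩ (Stage.iUnion f).core : Set V) < #E :=
    mk_lt_mk_of_finite_of_infinite (encard_lt_top_iff.1 (hcore.trans_le le_top)) hinf
  exact (mk_le_mk_of_subset (subset_inter inter_subset_left hnew)).trans_lt
    (mk_inter_union_lt hinf hold hcore_lt)

theorem iUnion_large_meets (hf : ∀ i j, i ≤ j → (f i).Extends 𝓔 (θ i) (f j))
    (hadm : ∀ i, (f i).IsAdmissible 𝓔 (θ i)) {E : Set V} (hE : E ∈ (Stage.iUnion f).large) :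
    ¬ Disjoint E (Stage.iUnion f).chosen := by
  obtain ⟨i, hi⟩ := mem_iUnion.1 hE
  exact (hadm i).large_meets_of_le (extends_iUnion hf i).le hi

theorem mk_inter_iUnion_lt (hr : AlmostDisjoint 𝓔 r)
    (hf : ∀ i j, i ≤ j → (f i).Extends 𝓔 (θ i) (f j)) (hadm : ∀ i, (f i).IsAdmissible 𝓔 (θ i))
    {E : Set V} (hE : E ∈ 𝓔) (hinf : E.Infinite) (hdis : Disjoint E (Stage.iUnion f).chosen)
    (hcore : #(Stage.iUnion f).core < #E) (hlarge : #(Stage.iUnion f).large < #E) :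
    #(E ∩ (Stage.iUnion f).decided : Set V) < #E := by
  rw [(Stage.iUnion f).decided_eq]
  refine mk_inter_union_lt hinf ((mk_le_mk_of_subset inter_subset_right).trans_lt hcore) ?_
  exact hr.mk_inter_sUnion_lt hE hinf (iUnion_subset fun i => (hadm i).large_subset)
    (fun hEL => iUnion_large_meets hf hadm hEL hdis) hlarge

theorem isPartialCover_iUnion (hr : AlmostDisjoint 𝓔 r) (hne : ∀ E ∈ 𝓔, E.Nonempty)
    (hθ : Monotone θ) (hf : ∀ i j, i ≤ j → (f i).Extends 𝓔 (θ i) (f j))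
    (hadm : ∀ i, (f i).IsAdmissible 𝓔 (θ i)) (hmeets : ∀ i, (f i).MeetsCore 𝓔 r (θ i))
    (hgap : ∀ E ∈ 𝓔, E.Infinite → (∀ i, θ i ≤ #E) →
      #(Stage.iUnion f).core < #E ∧ #(Stage.iUnion f).large < #E) :
    IsPartialCover 𝓔 (Stage.iUnion f).toPartialChoice where
  exists_private y hy := by
    obtain ⟨i, hi⟩ := mem_iUnion.1 hy
    exact (hadm i).partialCover.exists_private_of_le (extends_iUnion hf i).le hi
  not_subset_of_finite E hE hfin hdis :=
    not_subset_iUnion_of_finite hf hadm hE (hne E hE) hfin hdis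
  mk_inter_lt_or_trace E hE hinf hdis := by
    by_cases hlarge : ∀ i, θ i ≤ #E
    · obtain ⟨hcore_lt, hlarge_lt⟩ := hgap E hE hinf hlarge
      exact Or.inl (mk_inter_iUnion_lt hr hf hadm hE hinf hdis hcore_lt hlarge_lt)
    · push Not at hlarge
      obtain ⟨i, hi⟩ := hlarge
      exact mk_inter_iUnion_lt_or_trace hθ hf hadm hmeets hE hinf hdis hi

end Chain

end Stage

theorem exists_chain {ι σ : Type*} [LinearOrder ι] [WellFoundedLT ι] [Nonempty σ]
    {P : ι → σ → Prop} {R : ι → σ → σ → Prop} (hrefl : ∀ i s, R i s s)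
    (hstep : ∀ i (f : Iio i → σ), (∀ j : Iio i, P j (f j)) →
      (∀ j k : Iio i, j ≤ k → R j (f j) (f k)) → ∃ s, P i s ∧ ∀ j : Iio i, R j (f j) s) :
    ∃ f : ι → σ, (∀ i, P i (f i)) ∧ ∀ i j, i ≤ j → R i (f i) (f j) := by
  classical
  let next (i : ι) (g : ∀ j, j < i → σ) : σ :=
    Classical.epsilon fun s => P i s ∧ ∀ j : Iio i, R j (g j j.2) s
  let f : ι → σ := wellFounded_lt.fix next
  have hf (i : ι) : P i (f i) ∧ ∀ j < i, R j (f j) (f i) := by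
    induction i using WellFoundedLT.induction with
    | _ i ih =>
      have hchain (j k : Iio i) (hjk : j ≤ k) : R j (f j) (f k) := by
        rcases hjk.eq_or_lt with rfl | hlt
        exacts [hrefl _ _, (ih k k.2).2 j hlt]
      have hspec := Classical.epsilon_spec (hstep i (fun j => f j) (fun j => (ih j j.2).1) hchain)
      have hfix : f i = next i fun j _ => f j := wellFounded_lt.fix_eq next i
      rw [hfix]
      exact ⟨hspec.1, fun j hj => hspec.2 ⟨j, hj⟩⟩
  refine ⟨f, fun i => (hf i).1, fun i j hij => ?_⟩
  rcases hij.eq_or_lt with rfl | hlt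
  exacts [hrefl _ _, (hf j).2 i hlt]

section Chain

variable {𝓔 : Set (Set V)} {r : ℕ} {ι : Type u} [LinearOrder ι]

/-- Sizes `θ i` for the stages of a transfinite construction that stay small at limits: earlier
stages add up to less than `θ i`, and to less than any infinite `μ ∈ S` that is at least all earlier
`θ j`. -/
structure IsSizeBound (S : Set Cardinal.{u}) (θ : ι → Cardinal.{u}) : Prop where
  mono : Monotone θ
  aleph0_le : ∀ i, ℵ₀ ≤ θ i
  sum_lt : ∀ (i : ι) (c : Iio i → Cardinal.{u}), (∀ j : Iio i, c j < θ j) → Cardinal.sum c < θ i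
  sum_lt_of_mem : ∀ i : ι, ∀ μ ∈ S, ℵ₀ ≤ μ → (∀ j : Iio i, θ j ≤ μ) →
    ∀ c : Iio i → Cardinal.{u}, (∀ j : Iio i, c j < θ j) → Cardinal.sum c < μ

theorem IsSizeBound.isAdmissible_iUnion {S : Set Cardinal.{u}} {θ : ι → Cardinal.{u}}
    (hθ : IsSizeBound S θ) (hr : AlmostDisjoint 𝓔 r) (hne : ∀ E ∈ 𝓔, E.Nonempty)
    (hS : ∀ E ∈ 𝓔, E.Infinite → #E ∈ S) {i : ι} {f : Iio i → Stage V}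
    (hf : ∀ j k : Iio i, j ≤ k → (f j).Extends 𝓔 (θ j) (f k))
    (hadm : ∀ j : Iio i, (f j).IsAdmissible 𝓔 (θ j))
    (hmeets : ∀ j : Iio i, (f j).MeetsCore 𝓔 r (θ j)) : (Stage.iUnion f).IsAdmissible 𝓔 (θ i) where
  partialCover := by
    refine Stage.isPartialCover_iUnion hr hne (fun j k hjk => hθ.mono hjk) hf hadm hmeets
      fun E hE hinf hsmall => ?_
    have hsum := hθ.sum_lt_of_mem i _ (hS E hE hinf) (aleph0_le_mk_of_infinite hinf) hsmall
    exact ⟨mk_iUnion_le_sum_mk.trans_lt (hsum _ fun j => (hadm j).core_lt),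
      mk_iUnion_le_sum_mk.trans_lt (hsum _ fun j => (hadm j).large_lt)⟩
  large_subset := iUnion_subset fun j => (hadm j).large_subset
  large_meets _ hE := Stage.iUnion_large_meets hf hadm hE
  core_lt := mk_iUnion_le_sum_mk.trans_lt (hθ.sum_lt i _ fun j => (hadm j).core_lt)
  large_lt := mk_iUnion_le_sum_mk.trans_lt (hθ.sum_lt i _ fun j => (hadm j).large_lt)

theorem IsSizeBound.exists_isPrivateCover [WellFoundedLT ι] {S : Set Cardinal.{u}}
    {θ : ι → Cardinal.{u}} (hθ : IsSizeBound S θ) (hr : AlmostDisjoint 𝓔 r)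
    (hne : ∀ E ∈ 𝓔, E.Nonempty) (hS : ∀ E ∈ 𝓔, E.Infinite → #E ∈ S)
    (hext : ∀ i, Extendable 𝓔 r (θ i)) (e : ι ≃ 𝓔) : ∃ Y, IsPrivateCover 𝓔 Y := by
  have : Nonempty (Stage V) := ⟨Stage.iUnion Empty.elim⟩
  obtain ⟨f, hf, hchain⟩ := exists_chain
    (P := fun i (s : Stage V) => s.IsAdmissible 𝓔 (θ i) ∧ s.MeetsCore 𝓔 r (θ i) ∧
      ¬ Disjoint (e i).1 s.chosen)
    (R := fun i s t => s.Extends 𝓔 (θ i) t) (fun i => Stage.Extends.refl 𝓔 (θ i)) (by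
      intro i f hf hchain
      obtain ⟨t, ht, htcore, hUt, het⟩ :=
        (hθ.isAdmissible_iUnion hr hne hS hchain (fun j => (hf j).1)
          fun j => (hf j).2.1).exists_extends hr (hθ.aleph0_le i) (hext i) (e i).2
      exact ⟨t, ⟨ht, htcore, het⟩,
        fun j => (Stage.extends_iUnion hchain j).trans hUt (hθ.mono j.2.le)⟩)
  have hU (i : ι) := (Stage.extends_iUnion hchain i).le
  refine ⟨(Stage.iUnion f).chosen, fun E hE => ?_, fun y hy => ?_⟩
  · have hmeets := (hf (e.symm ⟨E, hE⟩)).2.2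
    rw [e.apply_symm_apply] at hmeets
    rw [inter_comm, ← not_disjoint_iff_nonempty_inter]
    exact fun hdis => hmeets (PartialChoice.disjoint_chosen_of_le (hU _) hdis)
  · obtain ⟨i, hi⟩ := mem_iUnion.1 hy
    obtain ⟨E, hE, -, hyE⟩ := (hf i).1.partialCover.exists_private_of_le (hU i) hi
    exact ⟨E, hE, hyE⟩

end Chain

/-! ### Sizes -/

theorem sum_le_of_forall_le {ι : Type u} {c : ι → Cardinal.{u}} {κ : Cardinal.{u}} (hκ : ℵ₀ ≤ κ)
    (hι : #ι ≤ κ) (hc : ∀ i, c i ≤ κ) : Cardinal.sum c ≤ κ :=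
  (sum_le_mk_mul_iSup c).trans ((mul_le_mul' hι (ciSup_le' hc)).trans_eq (mul_eq_self hκ))

theorem mk_Iio_lt_of_ord {c : Cardinal.{u}} (i : c.ord.ToType) : #(Iio i) < c := by
  simpa only [mk_ord_toType] using mk_Iio_lt i (by simp)

theorem mk_Iio_le_of_forall_lt {α : Type u} [LinearOrder α] [WellFoundedLT α] {ν : Cardinal.{u}}
    {i : α} (h : ∀ j < i, #(Iio j) < ν) : #(Iio i) ≤ ν := by
  by_contra! hlt
  have hi : ν.ord < Ordinal.typein (α := α) (· < ·) i := (ord_lt_ord.2 hlt).trans_le (ord_card_le _)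
  obtain ⟨j, hj⟩ := Ordinal.typein_surj (α := α) (· < ·) (hi.trans (Ordinal.typein_lt_type _ i))
  rw [← hj, Ordinal.typein_lt_typein] at hi
  have hcard : #(Iio j) = ν := (congrArg Ordinal.card hj).trans (card_ord ν)
  exact (h j hi).ne hcard

section SizeBound

variable {ι : Type u} [LinearOrder ι] {S : Set Cardinal.{u}}

theorem isSizeBound_aleph0 (S : Set Cardinal.{u}) (hfin : ∀ i : ι, #(Iio i) < ℵ₀) :
    IsSizeBound S fun _ : ι => ℵ₀ where
  mono := monotone_const
  aleph0_le _ := le_rfl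
  sum_lt i _ hc := sum_lt_of_isRegular isRegular_aleph0 (hfin i) hc
  sum_lt_of_mem i _ _ hμ _ _ hc :=
    (sum_lt_of_isRegular isRegular_aleph0 (hfin i) hc).trans_le hμ

theorem isSizeBound_succ {κ : ι → Cardinal.{u}} (hmono : Monotone κ) (hκ : ∀ i, ℵ₀ ≤ κ i)
    (hι : ∀ i, #(Iio i) ≤ κ i)
    (hgap : ∀ i, ∀ μ ∈ S, (Iio i).Nonempty → (∀ j < i, κ j < μ) →
      ∃ ν < μ, #(Iio i) ≤ ν ∧ ∀ j < i, κ j ≤ ν) :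
    IsSizeBound S fun i => Order.succ (κ i) where
  mono := Order.succ_mono.comp hmono
  aleph0_le i := (hκ i).trans (Order.le_succ _)
  sum_lt i c hc := Order.lt_succ_iff.2 <| sum_le_of_forall_le (hκ i) (hι i) fun j =>
    (Order.lt_succ_iff.1 (hc j)).trans (hmono j.2.le)
  sum_lt_of_mem i μ hμS hμ hle c hc := by
    rcases (Iio i).eq_empty_or_nonempty with hempty | ⟨j, hj⟩
    · have : IsEmpty (Iio i) := isEmpty_coe_sort.2 hempty
      exact (mk_eq_zero _).trans_lt (aleph0_pos.trans_le hμ)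
    · obtain ⟨ν, hν, hιν, hκν⟩ :=
        hgap i μ hμS ⟨j, hj⟩ fun k hk => Order.succ_le_iff.1 (hle ⟨k, hk⟩)
      refine (sum_le_of_forall_le ((hκ j).trans (hκν j hj)) hιν fun k => ?_).trans_lt hν
      exact (Order.lt_succ_iff.1 (hc k)).trans (hκν k k.2)

end SizeBound

section CofinalAvoiding

variable {S : Set Cardinal.{u}} {lam : Cardinal.{u}}

/-- A cofinal set of infinite cardinals below `lam` none of whose limits below `lam` is in `S`. -/
structure IsCofinalAvoiding (S : Set Cardinal.{u}) (lam : Cardinal.{u}) (C : Set Cardinal.{u}) :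
    Prop where
  subset_Ico : C ⊆ Ico ℵ₀ lam
  exists_gt : ∀ c < lam, ∃ d ∈ C, c < d
  exists_bound : ∀ μ ∈ S, μ < lam → (C ∩ Iio μ).Nonempty → ∃ ν < μ, C ∩ Iio μ ⊆ Iic ν

/-- The function `Cardinal.ord`, as a map between the initial segments below `lam` and `lam.ord`. -/
noncomputable def initialOrd (lam : Cardinal.{u}) (c : Ico ℵ₀ lam) : Iio lam.ord :=
  ⟨ord c, ord_lt_ord.2 c.2.2⟩

theorem strictMono_initialOrd (lam : Cardinal.{u}) : StrictMono (initialOrd lam) :=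
  fun _ _ h => ord_lt_ord.2 h

theorem isCofinal_range_initialOrd (hlam : ℵ₀ < lam) (hlim : Order.IsSuccPrelimit lam) :
    IsCofinal (range (initialOrd lam)) := by
  intro x
  have hx : max ℵ₀ (Order.succ x.1.card) < lam := max_lt hlam (hlim.succ_lt (lt_ord.1 x.2))
  refine ⟨_, ⟨⟨_, le_max_left _ _, hx⟩, rfl⟩, ?_⟩
  exact (lt_ord.2 ((Order.lt_succ _).trans_le (le_max_right _ _))).le

theorem isClub_range_initialOrd (hlam : ℵ₀ < lam) (hlim : Order.IsSuccPrelimit lam) :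
    IsClub (range (initialOrd lam)) where
  isCofinal := isCofinal_range_initialOrd hlam hlim
  dirSupClosed := by
    rintro t ht ⟨a, ha⟩ - x hx
    have hcard {b : Iio lam.ord} (hb : b ∈ t) : ∃ c : Cardinal.{u}, ℵ₀ ≤ c ∧ c ≤ x.1.card ∧
        b.1 = c.ord := by
      obtain ⟨c, rfl⟩ := ht hb
      exact ⟨c, c.2.1, ord_le.1 (hx.1 hb), rfl⟩
    have hxlam : x.1.card < lam := lt_ord.1 x.2
    obtain ⟨c, hc, hcx, -⟩ := hcard ha
    refine ⟨⟨x.1.card, hc.trans hcx, hxlam⟩, le_antisymm (ord_card_le _) (hx.2 fun b hb => ?_)⟩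
    obtain ⟨c, -, hcx, hbc⟩ := hcard hb
    exact hbc.trans_le (ord_le_ord.2 hcx)

theorem cof_Iio_ord (lam : Cardinal.{u}) :
    Order.cof (Iio lam.ord) = Cardinal.lift.{u + 1} lam.ord.cof := by
  rw [Ordinal.cof_Iio, ← Ordinal.lift_cof]

theorem isCofinalAvoiding_of_isClub (hlim : Order.IsSuccPrelimit lam) {D : Set (Iio lam.ord)}
    (hD : IsClub D) (hinit : D ⊆ range (initialOrd lam))
    (hdis : Disjoint ((fun x : Iio lam.ord => (x : Ordinal.{u})) ⁻¹' (ord '' S)) D) :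
    IsCofinalAvoiding S lam (Subtype.val '' (initialOrd lam ⁻¹' D)) where
  subset_Ico := by
    rintro _ ⟨c, -, rfl⟩
    exact c.2
  exists_gt c hc := by
    obtain ⟨x, hxD, hx⟩ := hD.isCofinal ⟨_, ord_lt_ord.2 (hlim.succ_lt hc)⟩
    obtain ⟨d, rfl⟩ := hinit hxD
    exact ⟨d, ⟨d, hxD, rfl⟩, Order.succ_le_iff.1 (ord_le_ord.1 hx)⟩
  exists_bound := by
    rintro μ hμS hμ ⟨_, ⟨c, hcD, rfl⟩, hcμ⟩
    by_contra! hunbounded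
    have hmem : (⟨μ.ord, ord_lt_ord.2 hμ⟩ : Iio lam.ord) ∈ D := by
      refine hD.isLUB_mem (t := {x ∈ D | x.1 < μ.ord}) (sep_subset _ _)
        ⟨_, hcD, ord_lt_ord.2 hcμ⟩ ⟨fun x hx => hx.2.le, fun b hb => ?_⟩
      by_contra! hlt
      obtain ⟨_, ⟨⟨a, haD, rfl⟩, haμ⟩, hab⟩ :=
        not_subset.1 (hunbounded b.1.card (lt_ord.1 hlt))
      exact hab (ord_le.1 (hb ⟨haD, ord_lt_ord.2 haμ⟩))
    exact disjoint_left.1 hdis ⟨μ, hμS, rfl⟩ hmem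

theorem exists_isCofinalAvoiding_of_aleph0_lt_cof (hS : NowhereStationaryCardinals S)
    (hlam : ℵ₀ < lam) (hlim : Order.IsSuccPrelimit lam) (hcof : ℵ₀ < lam.ord.cof) :
    ∃ C, IsCofinalAvoiding S lam C := by
  obtain ⟨D, hD, hdis⟩ := not_isStationary_iff.1 (hS lam.ord hcof)
  have hcof' : Order.cof (Iio lam.ord) ≠ ℵ₀ := by
    rw [cof_Iio_ord]
    exact (aleph0_lt_lift.2 hcof).ne'
  exact ⟨_, isCofinalAvoiding_of_isClub hlim (hD.inter hcof' (isClub_range_initialOrd hlam hlim))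
    inter_subset_right (hdis.mono_right inter_subset_left)⟩

/-- A cofinal set of order type at most `ω` has no limits at all. -/
theorem exists_isCofinalAvoiding_of_cof_le_aleph0 (S : Set Cardinal.{u}) (hlam : ℵ₀ < lam)
    (hlim : Order.IsSuccPrelimit lam) (hcof : lam.ord.cof ≤ ℵ₀) :
    ∃ C, IsCofinalAvoiding S lam C := by
  have hcof' : Order.cof (Ico ℵ₀ lam) ≤ ℵ₀ := by
    rw [Order.cof_congr_of_strictMono (strictMono_initialOrd lam)
      (isCofinal_range_initialOrd hlam hlim), cof_Iio_ord]
    exact lift_le_aleph0.2 hcof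
  obtain ⟨C, hC, htype⟩ := Ordinal.exists_ord_cof_eq (Ico ℵ₀ lam)
  have hgt : ∀ c < lam, ∃ d ∈ Subtype.val '' C, c < d := by
    intro c hc
    obtain ⟨d, hd, hcd⟩ := hC ⟨_, le_max_left _ _, max_lt hlam (hlim.succ_lt hc)⟩
    exact ⟨d, ⟨d, hd, rfl⟩, Order.succ_le_iff.1 ((le_max_right _ _).trans hcd)⟩
  have hfinite (d : C) : (Iio d).Finite := by
    have hC : #C = Order.cof (Ico ℵ₀ lam) := by
      simpa only [card_ord, Ordinal.card_type] using congrArg Ordinal.card htype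
    have hlt := mk_Iio_lt d (by rw [htype, hC])
    exact lt_aleph0_iff_set_finite.1 (hlt.trans_le (hC.trans_le hcof'))
  refine ⟨Subtype.val '' C, ?_, hgt, fun μ _ hμ hne => ?_⟩
  · rintro _ ⟨c, -, rfl⟩
    exact c.2
  · obtain ⟨_, ⟨d, hd, rfl⟩, hμd⟩ := hgt μ hμ
    have hfin : (Subtype.val '' C ∩ Iio μ).Finite := by
      refine ((hfinite ⟨d, hd⟩).image fun c => c.1.1).subset ?_
      rintro _ ⟨⟨c, hc, rfl⟩, hcμ⟩
      exact ⟨⟨c, hc⟩, lt_trans hcμ hμd, rfl⟩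
    obtain ⟨ν, hν, hmax⟩ := exists_max_image _ id hfin hne
    exact ⟨ν, hν.2, hmax⟩

theorem exists_isCofinalAvoiding (hS : NowhereStationaryCardinals S)
    (hlam : ℵ₀ < lam) (hlim : Order.IsSuccPrelimit lam) : ∃ C, IsCofinalAvoiding S lam C := by
  rcases le_or_gt lam.ord.cof ℵ₀ with hcof | hcof
  exacts [exists_isCofinalAvoiding_of_cof_le_aleph0 S hlam hlim hcof,
    exists_isCofinalAvoiding_of_aleph0_lt_cof hS hlam hlim hcof]

end CofinalAvoiding

section Sizes

variable {S : Set Cardinal.{u}} {lam : Cardinal.{u}} {ι : Type u} [LinearOrder ι]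

theorem IsCofinalAvoiding.exists_isSizeBound [WellFoundedLT ι] {C : Set Cardinal.{u}}
    (hC : IsCofinalAvoiding S lam C) (hι : ∀ i : ι, #(Iio i) < lam) :
    ∃ κ : ι → Cardinal.{u}, (∀ i, κ i ∈ Ico ℵ₀ lam) ∧
      IsSizeBound S fun i => Order.succ (κ i) := by
  let κ (i : ι) : Cardinal.{u} := sInf {d ∈ C | #(Iio i) < d}
  have hne (i : ι) : {d ∈ C | #(Iio i) < d}.Nonempty := hC.exists_gt _ (hι i)
  have hκC (i : ι) : κ i ∈ C := (csInf_mem (hne i)).1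
  have hκ (i : ι) : #(Iio i) < κ i := (csInf_mem (hne i)).2
  have hmono : Monotone κ := fun i j hij => csInf_le_csInf' (hne j) fun d hd =>
    ⟨hd.1, (mk_le_mk_of_subset (Iio_subset_Iio hij)).trans_lt hd.2⟩
  refine ⟨κ, fun i => hC.subset_Ico (hκC i),
    isSizeBound_succ hmono (fun i => (hC.subset_Ico (hκC i)).1) (fun i => (hκ i).le) ?_⟩
  rintro i μ hμS ⟨j, hj⟩ hlt
  rcases lt_or_ge μ lam with hμ | hμ
  · obtain ⟨ν, hν, hle⟩ := hC.exists_bound μ hμS hμ ⟨κ j, hκC j, hlt j hj⟩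
    have hκν (k : ι) (hk : k < i) : κ k ≤ ν := hle ⟨hκC k, hlt k hk⟩
    exact ⟨ν, hν, mk_Iio_le_of_forall_lt fun k hk => (hκ k).trans_le (hκν k hk), hκν⟩
  · exact ⟨κ i, (hC.subset_Ico (hκC i)).2.trans_le hμ, (hκ i).le, fun k hk => hmono hk.le⟩

theorem isSizeBound_succ_const (S : Set Cardinal.{u}) {κ : Cardinal.{u}} (hκ : ℵ₀ ≤ κ)
    (hι : ∀ i : ι, #(Iio i) ≤ κ) : IsSizeBound S fun _ : ι => Order.succ κ :=
  isSizeBound_succ monotone_const (fun _ => hκ) hι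
    fun i _ _ ⟨j, hj⟩ hlt => ⟨κ, hlt j hj, hι i, fun _ _ => le_rfl⟩

theorem exists_isSizeBound [WellFoundedLT ι] (hS : NowhereStationaryCardinals S) (hlam : ℵ₀ < lam)
    (hι : ∀ i : ι, #(Iio i) < lam) :
    ∃ κ : ι → Cardinal.{u}, (∀ i, κ i ∈ Ico ℵ₀ lam) ∧
      IsSizeBound S fun i => Order.succ (κ i) := by
  by_cases hlim : Order.IsSuccPrelimit lam
  · obtain ⟨C, hC⟩ := exists_isCofinalAvoiding hS hlam hlim
    exact hC.exists_isSizeBound hι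
  · obtain ⟨κ, rfl⟩ := Order.mem_range_succ_of_not_isSuccPrelimit hlim
    have hκ : ℵ₀ ≤ κ := Order.lt_succ_iff.1 hlam
    exact ⟨fun _ => κ, fun _ => ⟨hκ, Order.lt_succ κ⟩,
      isSizeBound_succ_const S hκ fun i => Order.lt_succ_iff.1 (hι i)⟩

end Sizes

theorem exists_isPrivateCover {S : Set Cardinal.{u}} (hS : NowhereStationaryCardinals S)
    {lam : Cardinal.{u}} {X : Set V} {𝓔 : Set (Set V)} {r : ℕ} (hX : #X ≤ lam)
    (hsub : ∀ E ∈ 𝓔, E ⊆ X) (hne : ∀ E ∈ 𝓔, E.Nonempty) (hsize : ∀ E ∈ 𝓔, E.Infinite → #E ∈ S)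
    (hr : AlmostDisjoint 𝓔 r) : ∃ Y, IsPrivateCover 𝓔 Y := by
  induction lam using WellFoundedLT.induction generalizing X 𝓔 with
  | _ lam ih =>
    obtain ⟨e⟩ : Nonempty ((#𝓔).ord.ToType ≃ 𝓔) := Cardinal.eq.1 (mk_ord_toType _)
    rcases le_or_gt lam ℵ₀ with hlam | hlam
    · have h𝓔 : #𝓔 ≤ ℵ₀ := hr.mk_le le_rfl (hX.trans hlam) hsub
      have hbound := isSizeBound_aleph0 S fun i : (#𝓔).ord.ToType =>
        (mk_Iio_lt_of_ord i).trans_le h𝓔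
      exact hbound.exists_isPrivateCover hr hne hsize (fun _ => extendable_aleph0 𝓔 r) e
    · obtain ⟨κ, hκ, hbound⟩ := exists_isSizeBound hS hlam fun i : (#𝓔).ord.ToType =>
        (mk_Iio_lt_of_ord i).trans_le (hr.mk_le hlam.le hX hsub)
      refine hbound.exists_isPrivateCover hr hne hsize (fun i => ?_) e
      refine extendable_succ hr (hκ i).1 fun p M hp hM => ?_
      exact ih (κ i) (hκ i).2 hM (fun H hH => hH.2) (fun H hH => hp.nonempty_of_mem_residual hH.1)
        (fun H hH hinf => mk_mem_of_mem_residual hsize hH.1 hinf)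
        (hr.residual.mono (sep_subset _ _))

end Hypergraphs

theorem mainTheorem1 (S : Set Cardinal.{u}) (hS : NowhereStationaryCardinals S)
    (lam : Cardinal.{u}) (r : ℕ) :
    Hypergraphs.MinVC lam S 2 (r : Cardinal.{u}) := by
  intro V _ 𝓔 hne hsize hC
  obtain ⟨Y, hY⟩ := Hypergraphs.exists_isPrivateCover hS le_rfl (fun E _ => Set.subset_univ E) hne
    (fun E hE _ => hsize hE) hC.almostDisjoint
  exact ⟨Y, hY.isMinimalVertexCover⟩
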